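/- Let $d\ge 2$, let $\Omega=\{1,\dots,d\}^{\mathbb N}$ with the shift $\sigma$ and the metric $\rho(x,y)=2^{-N}$, $N$ being the first index at which $x$ and $y$ differ. For a Hölder potential $A:\Omega\to\mathbb R$ let $\mathcal L_Af(x)=\sum_{\sigma(y)=x}e^{A(y)}f(y)$ be the Ruelle operator. A Jacobian is a positive Hölder function $J$ with $\mathcal L_{\log J}1=1$; its Gibbs probability $\mu_J$ is the unique Borel probability with $\mathcal L_{\log J}^*\mu_J=\mu_J$. The equilibrium state of a Hölder potential $A$ is the Gibbs probability with Jacobian $e^{\Pi(A)}$, where $\Pi(A)=A+\log h-\log(h\circ\sigma)-\log c$ and $h>0$ is a Hölder eigenfunction of $\mathcal L_A$ with eigenvalue $c>0$. For Gibbs probabilities $\mu,\nu$ with Jacobians $J_\mu,J_\nu$ put $D_{KL}(\mu,\nu)=\int(\log J_\mu-\log J_\nu)\,d\mu$. Let $\mu_0,\mu_1,\mu_2$ be Gibbs probabilities with Hölder Jacobians $J_0,J_1,J_2$ respectively. Then for every $\lambda\in\mathbb R$ the potential $\lambda\log J_2+(1-\lambda)\log J_0$ has a unique equilibrium state $\mu^\lambda$;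 one has $\mu^0=\mu_0$ and the state at $\lambda=1$ is $\mu_2$. Moreover $\lambda\mapsto D_{KL}(\mu_1,\mu^\lambda)$ is differentiable at $\lambda=0$, with $$\frac{d}{d\lambda}\Big|_{\lambda=0}D_{KL}(\mu_1,\mu^\lambda)=-\int(\log J_2-\log J_0)\,d\mu_1+\int(\log J_2-\log J_0)\,d\mu_0,$$ and this derivative is nonnegative if and only if the Pythagorean inequality $$D_{KL}(\mu_1,\mu_0)+D_{KL}(\mu_0,\mu_2)\le D_{KL}(\mu_1,\mu_2)$$ holds. (Here $\mu_1$ is arbitrary; it need not be the equilibrium state at $\lambda=1$.) -/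

import Mathlib

open MeasureTheory

namespace ShiftThermo

/-- The one-sided full shift space on `d` symbols (the symbols are labelled `0, …, d - 1`), with
its product topology and product (= Borel) σ-algebra. -/
abbrev ShiftSpace (d : ℕ) : Type := ℕ → Fin d

/-- The shift `σ(x₀, x₁, x₂, …) = (x₁, x₂, x₃, …)`. -/
def shift {d : ℕ} (x : ShiftSpace d) : ShiftSpace d := fun n => x (n + 1)

/-- The sequence `(a, x₀, x₁, …)`. -/
def prepend {d : ℕ} (a : Fin d) (x : ShiftSpace d) : ShiftSpace d
  | 0 => a
  | n + 1 => x n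

/-- The sequences `(a, x₀, x₁, …)` are exactly the preimages of `x` under the shift. -/
theorem shift_eq_iff {d : ℕ} (x y : ShiftSpace d) : shift y = x ↔ ∃ a, y = prepend a x := by
  constructor
  · rintro rfl
    exact ⟨y 0, funext fun n => by cases n <;> rfl⟩
  · rintro ⟨a, rfl⟩
    rfl

/-- Different first symbols give different preimages. -/
theorem prepend_injective {d : ℕ} (x : ShiftSpace d) : Function.Injective fun a => prepend a x :=
  fun _ _ h => congrFun h 0

/-- The usual metric on the shift space: `2 ^ (-N)`, with `N` the first index at which the two
sequences differ (and `0` if they are equal). -/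
noncomputable def seqDist {d : ℕ} (x y : ShiftSpace d) : ℝ :=
  (PiNat.dist : Dist (ShiftSpace d)).dist x y

/-- Hölder continuity of a real function on the shift space (for some positive exponent). -/
def IsHolder {d : ℕ} (f : ShiftSpace d → ℝ) : Prop :=
  ∃ C α : ℝ, 0 < α ∧ ∀ x y, |f x - f y| ≤ C * seqDist x y ^ α

/-- The Ruelle operator `(L_A f)(x) = ∑_{σ(y) = x} e^{A(y)} f(y)`. -/
noncomputable def ruelle {d : ℕ} (A f : ShiftSpace d → ℝ) (x : ShiftSpace d) : ℝ :=
  ∑ a : Fin d, Real.exp (A (prepend a x)) * f (prepend a x)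

/-- A Hölder Jacobian: a positive Hölder function `J` with `L_{log J} 1 = 1`. -/
structure IsJacobian {d : ℕ} (J : ShiftSpace d → ℝ) : Prop where
  pos : ∀ x, 0 < J x
  holder : IsHolder J
  ruelle_one : ruelle (fun x => Real.log (J x)) 1 = 1

/-- A point of the manifold `𝒩` of Hölder Gibbs probabilities: a Hölder Jacobian `J` together with
a Borel probability `μ` fixed by the dual Ruelle operator, `L_{log J}^* μ = μ`, that is
`∫ L_{log J} f dμ = ∫ f dμ` for every continuous `f`. -/
@[ext]
structure GibbsState (d : ℕ) where
  /-- the Jacobian -/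
  J : ShiftSpace d → ℝ
  /-- the probability -/
  μ : Measure (ShiftSpace d)
  isJacobian : IsJacobian J
  isProbabilityMeasure : IsProbabilityMeasure μ
  dual_ruelle : ∀ f : ShiftSpace d → ℝ, Continuous f →
    ∫ x, ruelle (fun y => Real.log (J y)) f x ∂μ = ∫ x, f x ∂μ

/-- `ν` is the equilibrium state of the potential `A`: there are a positive Hölder eigenfunction `h`
of the Ruelle operator `L_A`, with (main) eigenvalue `c > 0`, such that `ν` is the Gibbs probability
whose Jacobian is `e^{Π(A)}`, where `Π(A) = A + log h - log (h ∘ σ) - log c` is the normalization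
of `A`. -/
def IsEquilibriumState {d : ℕ} (A : ShiftSpace d → ℝ) (ν : GibbsState d) : Prop :=
  ∃ (h : ShiftSpace d → ℝ) (c : ℝ), IsHolder h ∧ (∀ x, 0 < h x) ∧ 0 < c ∧
    (∀ x, ruelle A h x = c * h x) ∧
    ∀ x, Real.log (ν.J x) = A x + Real.log (h x) - Real.log (h (shift x)) - Real.log c

/-- The Kullback–Leibler divergence `D_KL(ν, ρ) = ∫ (log J_ν - log J_ρ) dν` of Gibbs
probabilities. -/
noncomputable def DKL {d : ℕ} (ν ρ : GibbsState d) : ℝ :=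
  ∫ x, (Real.log (ν.J x) - Real.log (ρ.J x)) ∂ν.μ

/-- The potential `t log J₂ + (1 - t) log J₀`. -/
noncomputable def logInterp {d : ℕ} (J₀ J₂ : ShiftSpace d → ℝ) (t : ℝ) (x : ShiftSpace d) : ℝ :=
  t * Real.log (J₂ x) + (1 - t) * Real.log (J₀ x)

end ShiftThermo

namespace ShiftThermo

open Set Filter Topology

/-! Put `ψ = log J₂ - log J₀` and let `c t` be the eigenvalue of the potential `log J₀ + t ψ`. The
log-Jacobian of the equilibrium state is this potential plus a coboundary minus `log (c t)`. Since
`μ₁` is shift-invariant, the coboundary integrates to zero, so `DKL ν₁ (ν t)` is an affine function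
of `t` with slope `-∫ ψ dμ₁`, plus `log (c t)` (`DKL_eq_of_normalization`). Everything reduces to
showing that `log (c t)` has derivative `∫ ψ dμ₀` at `0`. The derivative of the divergence then
equals `DKL ν₁ ν₂ - DKL ν₁ ν₀ - DKL ν₀ ν₂`, which gives the equivalence.

The derivative of `log (c t)` needs no perturbation theory of operators. For any positive continuous
`g`, the eigenvalue lies between the extreme values of `L g / g` (`le_eigenvalue`, `eigenvalue_le`).
The test function is `g = e^{tu}`, where `u` nearly solves `L(ψ + u) - u = ∫ ψ dμ₀` for `L = L_{log
J₀}`; such `u` exist because `L^k ψ` converges uniformly to a constant (`exists_iterate_mem_Icc`).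
The same convergence yields existence and uniqueness of Gibbs probabilities. Eigenfunctions come
from a vanishing-discount limit (`exists_eigenfunction`). -/

/-- The sequences `x` and `y` have the same first `n` symbols. -/
def AgreeTo {d : ℕ} (n : ℕ) (x y : ShiftSpace d) : Prop := ∀ i < n, x i = y i

/-- The variation of `f` on cylinders of length `n` is at most `C * θ ^ n`. -/
def GeomVar {d : ℕ} (f : ShiftSpace d → ℝ) (C θ : ℝ) : Prop :=
  ∀ n x y, AgreeTo n x y → |f x - f y| ≤ C * θ ^ n

/-! ### Hölder functions as functions with geometrically decaying variations. -/

section Basic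

variable {d : ℕ}

theorem shift_prepend (a : Fin d) (x : ShiftSpace d) : shift (prepend a x) = x := rfl

theorem agreeTo_zero (x y : ShiftSpace d) : AgreeTo 0 x y := fun _ hi => absurd hi (Nat.not_lt_zero _)

theorem AgreeTo.mono {m n : ℕ} {x y : ShiftSpace d} (h : AgreeTo n x y) (hmn : m ≤ n) :
    AgreeTo m x y :=
  fun i hi => h i (hi.trans_le hmn)

theorem AgreeTo.prepend {n : ℕ} {x y : ShiftSpace d} (h : AgreeTo n x y) (a : Fin d) :
    AgreeTo (n + 1) (prepend a x) (prepend a y) := by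
  rintro (_ | i) hi
  · rfl
  · exact h i (by omega)

theorem AgreeTo.shift {n : ℕ} {x y : ShiftSpace d} (h : AgreeTo (n + 1) x y) :
    AgreeTo n (shift x) (shift y) :=
  fun i hi => h (i + 1) (by omega)

theorem continuous_prepend (a : Fin d) : Continuous (prepend a : ShiftSpace d → ShiftSpace d) := by
  refine continuous_pi fun n => ?_
  rcases n with _ | n
  · exact continuous_const
  · exact continuous_apply n

theorem continuous_shift : Continuous (shift : ShiftSpace d → ShiftSpace d) :=
  continuous_pi fun n => continuous_apply (n + 1)

theorem eventually_agreeTo (n : ℕ) (x : ShiftSpace d) : ∀ᶠ y in 𝓝 x, AgreeTo n y x := by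
  have h : ∀ i ∈ Finset.range n, ∀ᶠ y : ShiftSpace d in 𝓝 x, y i = x i := fun i _ =>
    (continuous_apply (A := fun _ : ℕ => Fin d) i).continuousAt.eventually
      ((isOpen_discrete {x i}).mem_nhds rfl)
  filter_upwards [(Finset.eventually_all _).2 h] with y hy i hi
  exact hy i (Finset.mem_range.2 hi)

theorem seqDist_nonneg (x y : ShiftSpace d) : 0 ≤ seqDist x y := by
  by_cases hne : x = y
  · subst hne
    exact (PiNat.dist_self x).ge
  · rw [show seqDist x y = (1 / 2) ^ PiNat.firstDiff x y from PiNat.dist_eq_of_ne hne]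
    positivity

theorem isHolder_iff {f : ShiftSpace d → ℝ} :
    IsHolder f ↔ ∃ C θ : ℝ, 0 ≤ C ∧ 0 < θ ∧ θ < 1 ∧ GeomVar f C θ := by
  constructor
  · rintro ⟨C, α, hα, h⟩
    refine ⟨max C 0, (1 / 2 : ℝ) ^ α, le_max_right _ _, by positivity,
      Real.rpow_lt_one (by norm_num) (by norm_num) hα, fun n x y hxy => ?_⟩
    have hd : seqDist x y ≤ (1 / 2) ^ n :=
      PiNat.mem_cylinder_iff_dist_le.1 fun i hi => hxy i hi
    have h0 : 0 ≤ seqDist x y := seqDist_nonneg x y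
    calc |f x - f y| ≤ C * seqDist x y ^ α := h x y
      _ ≤ max C 0 * seqDist x y ^ α := by gcongr; exact le_max_left _ _
      _ ≤ max C 0 * ((1 / 2 : ℝ) ^ n) ^ α := by gcongr
      _ = max C 0 * ((1 / 2 : ℝ) ^ α) ^ n := by
        rw [← Real.rpow_natCast_mul (by norm_num), mul_comm (n : ℝ), Real.rpow_mul_natCast (by norm_num)]
  · rintro ⟨C, θ, hC, h0, h1, h⟩
    have hl : Real.log (1 / 2) ≠ 0 := by
      rw [one_div, Real.log_inv]; exact neg_ne_zero.2 (Real.log_pos one_lt_two).ne'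
    have hl' : Real.log (1 / 2) < 0 := Real.log_neg (by norm_num) (by norm_num)
    -- The exponent `α` is the solution of `(1/2)^α = θ`.
    refine ⟨C, Real.log θ / Real.log (1 / 2), div_pos_of_neg_of_neg (Real.log_neg h0 h1) hl',
      fun x y => ?_⟩
    by_cases hne : x = y
    · subst hne
      rw [sub_self, abs_zero]
      exact mul_nonneg hC (Real.rpow_nonneg (seqDist_nonneg x x) _)
    · have hd : seqDist x y = (1 / 2) ^ PiNat.firstDiff x y := PiNat.dist_eq_of_ne hne
      have e : (1 / 2 : ℝ) ^ (Real.log θ / Real.log (1 / 2)) = θ := by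
        rw [Real.rpow_def_of_pos (by norm_num), mul_div_cancel₀ _ hl, Real.exp_log h0]
      rw [hd, ← Real.rpow_natCast_mul (by norm_num), mul_comm (_ : ℝ) (_ / _),
        Real.rpow_mul_natCast (by norm_num), e]
      exact h _ x y fun i hi => PiNat.apply_eq_of_lt_firstDiff hi

theorem GeomVar.continuous {f : ShiftSpace d → ℝ} {C θ : ℝ} (h : GeomVar f C θ) (h0 : 0 < θ)
    (h1 : θ < 1) : Continuous f := by
  refine continuous_iff_continuousAt.2 fun x => Metric.tendsto_nhds.2 fun ε hε => ?_
  have ht : Tendsto (fun n : ℕ => C * θ ^ n) atTop (𝓝 0) := by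
    simpa using (tendsto_pow_atTop_nhds_zero_of_lt_one h0.le h1).const_mul C
  obtain ⟨n, hn⟩ := (ht.eventually (gt_mem_nhds hε)).exists
  filter_upwards [eventually_agreeTo n x] with y hy
  exact (h n y x hy).trans_lt hn

theorem IsHolder.continuous {f : ShiftSpace d → ℝ} (h : IsHolder f) : Continuous f := by
  obtain ⟨C, θ, -, h0, h1, h⟩ := isHolder_iff.1 h
  exact h.continuous h0 h1

theorem isHolder_const (c : ℝ) : IsHolder fun _ : ShiftSpace d => c :=
  isHolder_iff.2 ⟨0, 1 / 2, le_rfl, by norm_num, by norm_num, fun n x y _ => by simp⟩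

theorem IsHolder.add {f g : ShiftSpace d → ℝ} (hf : IsHolder f) (hg : IsHolder g) :
    IsHolder fun x => f x + g x := by
  obtain ⟨C, θ, hC, h0, h1, h⟩ := isHolder_iff.1 hf
  obtain ⟨C', θ', hC', h0', h1', h'⟩ := isHolder_iff.1 hg
  refine isHolder_iff.2 ⟨C + C', max θ θ', add_nonneg hC hC', lt_max_of_lt_left h0,
    max_lt h1 h1', fun n x y hxy => ?_⟩
  calc |f x + g x - (f y + g y)| = |(f x - f y) + (g x - g y)| := by ring_nf
    _ ≤ |f x - f y| + |g x - g y| := abs_add_le _ _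
    _ ≤ C * θ ^ n + C' * θ' ^ n := add_le_add (h n x y hxy) (h' n x y hxy)
    _ ≤ C * max θ θ' ^ n + C' * max θ θ' ^ n := by
      gcongr
      · exact le_max_left _ _
      · exact le_max_right _ _
    _ = _ := by ring

theorem IsHolder.comp_of_lipschitz {f : ShiftSpace d → ℝ} (hf : IsHolder f) (φ : ℝ → ℝ) (K : ℝ)
    (hK : 0 ≤ K) (hφ : ∀ x y, |φ (f x) - φ (f y)| ≤ K * |f x - f y|) :
    IsHolder fun x => φ (f x) := by
  obtain ⟨C, θ, hC, h0, h1, h⟩ := isHolder_iff.1 hf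
  refine isHolder_iff.2 ⟨K * C, θ, mul_nonneg hK hC, h0, h1, fun n x y hxy => ?_⟩
  calc _ ≤ K * |f x - f y| := hφ x y
    _ ≤ K * (C * θ ^ n) := by gcongr; exact h n x y hxy
    _ = _ := by ring

theorem IsHolder.const_mul {f : ShiftSpace d → ℝ} (hf : IsHolder f) (c : ℝ) :
    IsHolder fun x => c * f x :=
  hf.comp_of_lipschitz (fun t => c * t) |c| (abs_nonneg c) fun x y => by
    rw [← mul_sub, abs_mul]

theorem IsHolder.sub {f g : ShiftSpace d → ℝ} (hf : IsHolder f) (hg : IsHolder g) :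
    IsHolder fun x => f x - g x := by
  simpa [sub_eq_add_neg] using hf.add (hg.const_mul (-1))

theorem IsHolder.comp_shift {f : ShiftSpace d → ℝ} (hf : IsHolder f) :
    IsHolder fun x => f (shift x) := by
  obtain ⟨C, θ, hC, h0, h1, h⟩ := isHolder_iff.1 hf
  -- The factor `1 / θ` pays for the symbol that the shift discards.
  refine isHolder_iff.2 ⟨C / θ, θ, by positivity, h0, h1, fun n x y hxy => ?_⟩
  rcases n with _ | n
  · have := h 0 _ _ (agreeTo_zero (shift x) (shift y))
    rw [pow_zero, mul_one] at this ⊢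
    exact this.trans (le_div_self hC h0 h1.le)
  · have := h n _ _ hxy.shift
    rwa [pow_succ', ← mul_assoc, div_mul_cancel₀ _ h0.ne']

theorem exists_bound {f : ShiftSpace d → ℝ} (hf : Continuous f) : ∃ M, 0 ≤ M ∧ ∀ x, |f x| ≤ M := by
  obtain ⟨M, hM⟩ := isCompact_univ.exists_bound_of_continuousOn hf.continuousOn
  exact ⟨max M 0, le_max_right _ _, fun x => (hM x (mem_univ x)).trans (le_max_left _ _)⟩

theorem exp_sub_exp_le {M s t : ℝ} (hs : s ≤ M) : 
    Real.exp s - Real.exp t ≤ Real.exp M * |s - t| := by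
  have h1 : Real.exp s * (1 - (s - t)) ≤ Real.exp t := by
    have := Real.add_one_le_exp (t - s)
    calc Real.exp s * (1 - (s - t)) ≤ Real.exp s * Real.exp (t - s) := by
          gcongr; linarith
      _ = Real.exp t := by rw [← Real.exp_add]; ring_nf
  have h2 : Real.exp s * (s - t) ≤ Real.exp M * |s - t| :=
    (mul_le_mul_of_nonneg_left (le_abs_self _) (Real.exp_pos s).le).trans
      (mul_le_mul_of_nonneg_right (Real.exp_le_exp.2 hs) (abs_nonneg _))
  nlinarith

theorem IsHolder.exp {f : ShiftSpace d → ℝ} (hf : IsHolder f) : IsHolder fun x => Real.exp (f x) := by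
  obtain ⟨M, hM0, hM⟩ := exists_bound hf.continuous
  refine hf.comp_of_lipschitz Real.exp (Real.exp M) (Real.exp_pos M).le fun x y => ?_
  refine abs_sub_le_iff.2 ⟨exp_sub_exp_le ((le_abs_self _).trans (hM x)), ?_⟩
  rw [abs_sub_comm]
  exact exp_sub_exp_le ((le_abs_self _).trans (hM y))

theorem exists_pos_le [NeZero d] {f : ShiftSpace d → ℝ} (hf : Continuous f) (h : ∀ x, 0 < f x) :
    ∃ δ, 0 < δ ∧ ∀ x, δ ≤ f x := by
  obtain ⟨x, -, hx⟩ := isCompact_univ.exists_isMinOn (univ_nonempty (α := ShiftSpace d))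
    hf.continuousOn
  exact ⟨f x, h x, fun y => hx (mem_univ y)⟩

theorem log_sub_log_le {δ s t : ℝ} (hδ : 0 < δ) (hs : 0 < s) (ht : δ ≤ t) :
    Real.log s - Real.log t ≤ δ⁻¹ * |s - t| := by
  have ht0 := hδ.trans_le ht
  rw [← Real.log_div hs.ne' ht0.ne']
  calc Real.log (s / t) ≤ s / t - 1 := Real.log_le_sub_one_of_pos (by positivity)
    _ = t⁻¹ * (s - t) := by field_simp
    _ ≤ δ⁻¹ * |s - t| := by
      exact (mul_le_mul_of_nonneg_left (le_abs_self _) (inv_pos.2 ht0).le).trans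
        (mul_le_mul_of_nonneg_right (inv_anti₀ hδ ht) (abs_nonneg _))

theorem IsHolder.log [NeZero d] {f : ShiftSpace d → ℝ} (hf : IsHolder f) (h : ∀ x, 0 < f x) :
    IsHolder fun x => Real.log (f x) := by
  obtain ⟨δ, hδ, hle⟩ := exists_pos_le hf.continuous h
  refine hf.comp_of_lipschitz Real.log δ⁻¹ (inv_pos.2 hδ).le fun x y => ?_
  refine abs_sub_le_iff.2 ⟨log_sub_log_le hδ (h x) (hle y), ?_⟩
  rw [abs_sub_comm]
  exact log_sub_log_le hδ (h y) (hle x)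

/-- Uniform continuity in terms of cylinders. Otherwise the pairs violating the bound would form a
decreasing sequence of nonempty compact sets, and a common point would lie on the diagonal. -/
theorem exists_agreeTo_lt {f : ShiftSpace d → ℝ} (hf : Continuous f) {ε : ℝ} (hε : 0 < ε) :
    ∃ n, ∀ x y, AgreeTo n x y → |f x - f y| ≤ ε := by
  by_contra! hcon
  let K : ℕ → Set (ShiftSpace d × ShiftSpace d) :=
    fun n => {p | AgreeTo n p.1 p.2 ∧ ε ≤ |f p.1 - f p.2|}
  have hcl : ∀ n, IsClosed (K n) := fun n => by
    refine IsClosed.inter ?_ (isClosed_le continuous_const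
      ((hf.comp continuous_fst).sub (hf.comp continuous_snd)).abs)
    show IsClosed {p : ShiftSpace d × ShiftSpace d | ∀ i < n, p.1 i = p.2 i}
    simp only [Set.ofPred_forall]
    exact isClosed_iInter fun i => isClosed_iInter fun _ =>
      isClosed_eq ((continuous_apply i).comp continuous_fst) ((continuous_apply i).comp continuous_snd)
  obtain ⟨p, hp⟩ := IsCompact.nonempty_iInter_of_sequence_nonempty_isCompact_isClosed K
    (fun n p hp => ⟨hp.1.mono n.le_succ, hp.2⟩)
    (fun n => let ⟨x, y, h, h'⟩ := hcon n; ⟨(x, y), h, h'.le⟩) (hcl 0).isCompact hcl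
  rw [mem_iInter] at hp
  have : p.1 = p.2 := funext fun i => (hp (i + 1)).1 i i.lt_succ_self
  have h2 := (hp 0).2
  rw [this, sub_self, abs_zero] at h2
  exact absurd h2 hε.not_ge

end Basic

/-! ### Convergence of normalized Ruelle operators; Gibbs probabilities. -/

section Transfer

variable {d : ℕ}

theorem continuous_ruelle {A f : ShiftSpace d → ℝ} (hA : Continuous A) (hf : Continuous f) :
    Continuous (ruelle A f) :=
  continuous_finsetSum _ fun a _ =>
    (Real.continuous_exp.comp (hA.comp (continuous_prepend a))).mul (hf.comp (continuous_prepend a))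

theorem continuous_ruelle_iterate {A f : ShiftSpace d → ℝ} (hA : Continuous A) (hf : Continuous f)
    (k : ℕ) : Continuous ((ruelle A)^[k] f) := by
  induction k with
  | zero => exact hf
  | succ k ih =>
    rw [Function.iterate_succ_apply']
    exact continuous_ruelle hA ih

theorem ruelle_mono (A : ShiftSpace d → ℝ) {f g : ShiftSpace d → ℝ} (h : ∀ x, f x ≤ g x)
    (x : ShiftSpace d) : ruelle A f x ≤ ruelle A g x :=
  Finset.sum_le_sum fun _ _ => mul_le_mul_of_nonneg_left (h _) (Real.exp_pos _).le

theorem ruelle_add (A f g : ShiftSpace d → ℝ) : ruelle A (f + g) = ruelle A f + ruelle A g := by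
  funext x
  simp [ruelle, mul_add, Finset.sum_add_distrib]

theorem ruelle_smul (A : ShiftSpace d → ℝ) (c : ℝ) (f : ShiftSpace d → ℝ) :
    ruelle A (c • f) = c • ruelle A f := by
  funext x
  simp only [ruelle, Pi.smul_apply, smul_eq_mul, Finset.mul_sum]
  exact Finset.sum_congr rfl fun a _ => by ring

theorem ruelle_mul_comp_shift (A f g : ShiftSpace d → ℝ) (x : ShiftSpace d) :
    ruelle A (fun y => g (shift y) * f y) x = g x * ruelle A f x := by
  simp only [ruelle, shift_prepend, Finset.mul_sum]
  exact Finset.sum_congr rfl fun _ _ => by ring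

theorem ruelle_iterate_add (A f g : ShiftSpace d → ℝ) (k : ℕ) :
    (ruelle A)^[k] (f + g) = (ruelle A)^[k] f + (ruelle A)^[k] g := by
  induction k with
  | zero => rfl
  | succ k ih => simp only [Function.iterate_succ_apply', ih, ruelle_add]

theorem ruelle_iterate_smul (A : ShiftSpace d → ℝ) (c : ℝ) (f : ShiftSpace d → ℝ) (k : ℕ) :
    (ruelle A)^[k] (c • f) = c • (ruelle A)^[k] f := by
  induction k with
  | zero => rfl
  | succ k ih => simp only [Function.iterate_succ_apply', ih, ruelle_smul]

/-- A potential is normalized when the constant function `1` is fixed by its Ruelle operator. -/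
def IsNormalized (A : ShiftSpace d → ℝ) : Prop := ruelle A 1 = 1

theorem IsNormalized.sum_exp {A : ShiftSpace d → ℝ} (hA : IsNormalized A) (x : ShiftSpace d) :
    ∑ a : Fin d, Real.exp (A (prepend a x)) = 1 := by
  simpa [ruelle] using congrFun hA x

theorem IsNormalized.ruelle_const {A : ShiftSpace d → ℝ} (hA : IsNormalized A) (c : ℝ) :
    ruelle A (fun _ => c) = fun _ => c := by
  funext x
  simp only [ruelle, ← Finset.sum_mul, hA.sum_exp, one_mul]

theorem IsNormalized.iterate_const {A : ShiftSpace d → ℝ} (hA : IsNormalized A) (c : ℝ) (k : ℕ) :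
    (ruelle A)^[k] (fun _ => c) = fun _ => c :=
  Function.iterate_fixed (hA.ruelle_const c) k

theorem IsNormalized.ruelle_mem_Icc {A : ShiftSpace d → ℝ} (hA : IsNormalized A)
    {f : ShiftSpace d → ℝ} {a b : ℝ} (h : ∀ x, f x ∈ Icc a b) (x : ShiftSpace d) :
    ruelle A f x ∈ Icc a b := by
  have h1 := ruelle_mono A (fun x => (h x).1) x
  have h2 := ruelle_mono A (fun x => (h x).2) x
  rw [hA.ruelle_const] at h1 h2
  exact ⟨h1, h2⟩

theorem IsNormalized.iterate_mem_Icc {A : ShiftSpace d → ℝ} (hA : IsNormalized A)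
    {f : ShiftSpace d → ℝ} {a b : ℝ} (h : ∀ x, f x ∈ Icc a b) (k : ℕ) (x : ShiftSpace d) :
    (ruelle A)^[k] f x ∈ Icc a b := by
  induction k generalizing x with
  | zero => exact h x
  | succ k ih =>
    rw [Function.iterate_succ_apply']
    exact hA.ruelle_mem_Icc ih x

/-- Bounded distortion of the iterates of a normalized Ruelle operator. -/
theorem IsNormalized.iterate_le_of_agreeTo {A : ShiftSpace d → ℝ} (hA : IsNormalized A) {C θ : ℝ}
    (hC : 0 ≤ C) (h0 : 0 < θ) (h1 : θ < 1) (hv : GeomVar A C θ)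
    {f : ShiftSpace d → ℝ} (hf : ∀ x, 0 ≤ f x) {ε : ℝ} (hε : 0 ≤ ε) (k n : ℕ)
    (hfk : ∀ x y, AgreeTo (n + k) x y → f y ≤ f x + ε) (x y : ShiftSpace d) (hxy : AgreeTo n x y) :
    (ruelle A)^[k] f y ≤
      Real.exp (C * θ ^ n / (1 - θ)) * ((ruelle A)^[k] f x + ε) := by
  have hnn : ∀ k x, 0 ≤ (ruelle A)^[k] f x := fun k x => by
    induction k generalizing x with
    | zero => exact hf x
    | succ k ih =>
      rw [Function.iterate_succ_apply']
      exact Finset.sum_nonneg fun a _ => mul_nonneg (Real.exp_pos _).le (ih _)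
  induction k generalizing n x y with
  | zero =>
    have h1' : 0 < 1 - θ := sub_pos.2 h1
    have := hfk x y hxy
    have h2 : 1 ≤ Real.exp (C * θ ^ n / (1 - θ)) := Real.one_le_exp (by positivity)
    exact this.trans (le_mul_of_one_le_left (add_nonneg (hf x) hε) h2)
  | succ k ih =>
    have h1' : 0 < 1 - θ := sub_pos.2 h1
    simp only [Function.iterate_succ_apply']
    have key : ∀ a : Fin d,
        Real.exp (A (prepend a y)) * (ruelle A)^[k] f (prepend a y) ≤
          Real.exp (C * θ ^ n / (1 - θ)) *
            (Real.exp (A (prepend a x)) * ((ruelle A)^[k] f (prepend a x) + ε)) := fun a => by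
      have e1 := ih (n + 1) (fun x y h => hfk x y (by rwa [show n + (k + 1) = n + 1 + k by ring]))
        (prepend a x) (prepend a y) (hxy.prepend a)
      have e2 : A (prepend a y) ≤ C * θ ^ n + A (prepend a x) := by
        have := (abs_sub_le_iff.1 (hv (n + 1) _ _ (hxy.prepend a))).2
        have h3 : C * θ ^ (n + 1) ≤ C * θ ^ n := by
          gcongr C * ?_
          exact pow_le_pow_of_le_one h0.le h1.le n.le_succ
        linarith
      -- Prepending a symbol lengthens the agreement by one, so the distortions of successive steps
      -- sum to a geometric series. The error `ε` is only averaged, since the weights sum to `1`.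
      have e3 : C * θ ^ n + C * θ ^ (n + 1) / (1 - θ) = C * θ ^ n / (1 - θ) := by
        field_simp
        ring
      calc _ ≤ Real.exp (C * θ ^ n + A (prepend a x)) *
            (Real.exp (C * θ ^ (n + 1) / (1 - θ)) * ((ruelle A)^[k] f (prepend a x) + ε)) :=
            mul_le_mul (Real.exp_le_exp.2 e2) e1 (hnn _ _) (Real.exp_pos _).le
        _ = _ := by rw [← e3, Real.exp_add, Real.exp_add]; ring
    calc ruelle A ((ruelle A)^[k] f) y
        ≤ ∑ a : Fin d, Real.exp (C * θ ^ n / (1 - θ)) *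
            (Real.exp (A (prepend a x)) * ((ruelle A)^[k] f (prepend a x) + ε)) :=
          Finset.sum_le_sum fun a _ => key a
      _ = _ := by
        rw [← Finset.mul_sum]
        simp only [mul_add, Finset.sum_add_distrib, ← Finset.sum_mul, hA.sum_exp, one_mul]
        rfl

/-- After sufficiently many steps, a normalized Ruelle operator contracts the range of a continuous
function by a factor that depends on the potential only. -/
theorem IsNormalized.exists_contract [NeZero d] {A : ShiftSpace d → ℝ} (hA : IsNormalized A)
    (hH : IsHolder A) : ∃ q : ℝ, 0 < q ∧ q < 1 ∧ ∀ f : ShiftSpace d → ℝ, Continuous f → ∀ a b,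
      (∀ x, f x ∈ Icc a b) → a < b → ∃ k a' b', b' - a' ≤ q * (b - a) ∧
        ∀ x, (ruelle A)^[k] f x ∈ Icc a' b' := by
  obtain ⟨C, θ, hC, h0, h1, hv⟩ := isHolder_iff.1 hH
  have h1' : 0 < 1 - θ := sub_pos.2 h1
  set D := Real.exp (C / (1 - θ)) with hD
  have hD1 : 1 ≤ D := Real.one_le_exp (by positivity)
  have hD0 : 0 < D := one_pos.trans_le hD1
  have hDi : D⁻¹ ≤ 1 := inv_le_one_of_one_le₀ hD1
  have hDp : 0 < D⁻¹ := inv_pos.2 hD0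
  refine ⟨1 - D⁻¹ / 2, by linarith, by linarith, fun f hf a b hab hlt => ?_⟩
  set ε := (b - a) / (4 * D) with hε
  have hε0 : 0 < ε := div_pos (sub_pos.2 hlt) (by positivity)
  obtain ⟨k, hk⟩ := exists_agreeTo_lt hf hε0
  have hlow : ∀ g : ShiftSpace d → ℝ, (∀ x, 0 ≤ g x) → (∀ x y, AgreeTo k x y → g y ≤ g x + ε) →
      ∀ x y, D⁻¹ * (ruelle A)^[k] g y - ε ≤ (ruelle A)^[k] g x := fun g hg hgk x y => by
    have := hA.iterate_le_of_agreeTo hC h0 h1 hv hg hε0.le k 0 (by simpa using hgk) x y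
      (agreeTo_zero x y)
    rw [pow_zero, mul_one, ← hD] at this
    have h2 : D⁻¹ * (ruelle A)^[k] g y ≤ (ruelle A)^[k] g x + ε := by
      rw [inv_mul_le_iff₀ hD0]
      exact this
    linarith
  let x₀ : ShiftSpace d := fun _ => 0
  have e1 : ∀ x, (ruelle A)^[k] (f + fun _ => -a) x = (ruelle A)^[k] f x - a := fun x => by
    rw [ruelle_iterate_add, hA.iterate_const]; rfl
  have e2 : ∀ x, (ruelle A)^[k] ((-1 : ℝ) • f + fun _ => b) x = b - (ruelle A)^[k] f x := fun x => by
    rw [ruelle_iterate_add, hA.iterate_const, ruelle_iterate_smul]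
    simp only [Pi.add_apply, Pi.smul_apply, smul_eq_mul]
    ring
  set s := (ruelle A)^[k] f x₀ with hs
  -- Distortion applied to `f - a` and to `b - f` moves the two ends inwards by `D⁻¹ (s - a) - ε`
  -- and `D⁻¹ (b - s) - ε`. The total gain `D⁻¹ (b - a) - 2ε` is independent of `s` and equals `D⁻¹
  -- (b - a) / 2`.
  refine ⟨k, a + D⁻¹ * (s - a) - ε, b - D⁻¹ * (b - s) + ε, ?_, fun x => ⟨?_, ?_⟩⟩
  · have : ε = D⁻¹ * (b - a) / 4 := by rw [hε]; field_simp
    rw [this]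
    apply le_of_eq
    ring
  · have := hlow (f + fun _ => -a) (fun x => by have := (hab x).1; simp; linarith)
      (fun x y h => by have := (abs_sub_le_iff.1 (hk x y h)).2; simp; linarith) x x₀
    rw [e1, e1] at this
    linarith
  · have := hlow ((-1 : ℝ) • f + fun _ => b) (fun x => by have := (hab x).2; simp; linarith)
      (fun x y h => by have := (abs_sub_le_iff.1 (hk x y h)).1; simp; linarith) x x₀
    rw [e2, e2] at this
    linarith

/-- The iterates of a normalized Ruelle operator on a continuous function become constant in the
limit. -/
theorem IsNormalized.exists_iterate_mem_Icc [NeZero d] {A : ShiftSpace d → ℝ} (hA : IsNormalized A)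
    (hH : IsHolder A) {f : ShiftSpace d → ℝ} (hf : Continuous f) {ε : ℝ} (hε : 0 < ε) :
    ∃ K a b, b - a ≤ ε ∧ ∀ k ≥ K, ∀ x, (ruelle A)^[k] f x ∈ Icc a b := by
  suffices h : ∃ K a b, b - a ≤ ε ∧ ∀ x, (ruelle A)^[K] f x ∈ Icc a b by
    obtain ⟨K, a, b, hab, h⟩ := h
    refine ⟨K, a, b, hab, fun k hk x => ?_⟩
    obtain ⟨j, rfl⟩ := Nat.exists_eq_add_of_le' hk
    rw [Function.iterate_add_apply]
    exact hA.iterate_mem_Icc h j x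
  obtain ⟨q, hq0, hq1, hq⟩ := hA.exists_contract hH
  obtain ⟨M, hM0, hM⟩ := exists_bound hf
  have key : ∀ n : ℕ, ∃ K a b, b - a ≤ max ε (q ^ n * (2 * M)) ∧
      ∀ x, (ruelle A)^[K] f x ∈ Icc a b := fun n => by
    induction n with
    | zero =>
      refine ⟨0, -M, M, le_max_of_le_right (by linarith), fun x => abs_le.1 (hM x)⟩
    | succ n ih =>
      obtain ⟨K, a, b, hab, h⟩ := ih
      rcases le_or_gt (b - a) ε with hle | hlt
      · exact ⟨K, a, b, le_max_of_le_left hle, h⟩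
      · obtain ⟨k, a', b', hab', h'⟩ := hq _ (continuous_ruelle_iterate hH.continuous hf K) a b h
          (sub_pos.1 (hε.trans hlt))
        refine ⟨k + K, a', b', le_max_of_le_right ?_, fun x => ?_⟩
        · rcases le_max_iff.1 hab with h2 | h2
          · exact absurd h2 hlt.not_ge
          · calc b' - a' ≤ q * (b - a) := hab'
              _ ≤ q * (q ^ n * (2 * M)) := by gcongr
              _ = _ := by ring
        · rw [Function.iterate_add_apply]
          exact h' x
  have ht : Tendsto (fun n : ℕ => q ^ n * (2 * M)) atTop (𝓝 0) := by
    simpa using (tendsto_pow_atTop_nhds_zero_of_lt_one hq0.le hq1).mul_const (2 * M)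
  obtain ⟨n, hn⟩ := (ht.eventually (gt_mem_nhds hε)).exists
  obtain ⟨K, a, b, hab, h⟩ := key n
  exact ⟨K, a, b, hab.trans (max_le le_rfl hn.le), h⟩

theorem IsNormalized.exists_tendsto_iterate [NeZero d] {A : ShiftSpace d → ℝ} (hA : IsNormalized A)
    (hH : IsHolder A) {f : ShiftSpace d → ℝ} (hf : Continuous f) (x : ShiftSpace d) :
    ∃ l, Tendsto (fun k => (ruelle A)^[k] f x) atTop (𝓝 l) := by
  refine cauchySeq_tendsto_of_complete (Metric.cauchySeq_iff'.2 fun ε hε => ?_)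
  obtain ⟨K, a, b, hab, h⟩ := hA.exists_iterate_mem_Icc hH hf (half_pos hε)
  refine ⟨K, fun k hk => ?_⟩
  rw [Real.dist_eq]
  have h1 := h k hk x
  have h2 := h K le_rfl x
  refine (abs_sub_le_iff.2 ⟨?_, ?_⟩ : _ ≤ ε / 2).trans_lt (half_lt_self hε)
  · linarith [h1.2, h2.1]
  · linarith [h1.1, h2.2]

/-- A continuous function fixed by a normalized Ruelle operator is constant. -/
theorem IsNormalized.eq_of_ruelle_eq_self [NeZero d] {A : ShiftSpace d → ℝ} (hA : IsNormalized A)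
    (hH : IsHolder A) {f : ShiftSpace d → ℝ} (hf : Continuous f) (h : ruelle A f = f)
    (x y : ShiftSpace d) : f x = f y := by
  refine eq_of_forall_dist_le fun ε hε => ?_
  obtain ⟨K, a, b, hab, hK⟩ := hA.exists_iterate_mem_Icc hH hf hε
  have := hK K le_rfl
  rw [Function.iterate_fixed h] at this
  rw [Real.dist_eq]
  exact abs_sub_le_iff.2 ⟨by linarith [(this x).2, (this y).1], by linarith [(this y).2, (this x).1]⟩

/-! ### Probabilities fixed by the dual operator -/

theorem integrable_of_continuous {f : ShiftSpace d → ℝ} (hf : Continuous f)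
    (μ : Measure (ShiftSpace d)) [IsFiniteMeasure μ] : Integrable f μ :=
  hf.integrable_of_hasCompactSupport (HasCompactSupport.of_compactSpace f)

/-- The measure `μ` is fixed by the dual of the Ruelle operator of `A`. -/
def IsDualFixed (A : ShiftSpace d → ℝ) (μ : Measure (ShiftSpace d)) : Prop :=
  ∀ f : ShiftSpace d → ℝ, Continuous f → ∫ x, ruelle A f x ∂μ = ∫ x, f x ∂μ

theorem IsDualFixed.integral_iterate {A : ShiftSpace d → ℝ} (hc : Continuous A)
    {μ : Measure (ShiftSpace d)} (hμ : IsDualFixed A μ) {f : ShiftSpace d → ℝ} (hf : Continuous f)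
    (k : ℕ) : ∫ x, (ruelle A)^[k] f x ∂μ = ∫ x, f x ∂μ := by
  induction k with
  | zero => rfl
  | succ k ih =>
    rw [Function.iterate_succ_apply', hμ _ (continuous_ruelle_iterate hc hf k), ih]

theorem integral_mem_Icc {f : ShiftSpace d → ℝ} (hf : Continuous f) {a b : ℝ}
    (h : ∀ x, f x ∈ Icc a b) (μ : Measure (ShiftSpace d)) [IsProbabilityMeasure μ] :
    ∫ x, f x ∂μ ∈ Icc a b := by
  have h1 := integral_mono (integrable_const a) (integrable_of_continuous hf μ) fun x => (h x).1
  have h2 := integral_mono (integrable_of_continuous hf μ) (integrable_const b) fun x => (h x).2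
  simp only [integral_const, probReal_univ, one_smul] at h1 h2
  exact ⟨h1, h2⟩

/-- Shift-invariance: `L (f ∘ σ) = f · L 1 = f` for a normalized operator. -/
theorem IsDualFixed.integral_comp_shift {A : ShiftSpace d → ℝ} (hA : IsNormalized A)
    {μ : Measure (ShiftSpace d)} (hμ : IsDualFixed A μ) {f : ShiftSpace d → ℝ} (hf : Continuous f) :
    ∫ x, f (shift x) ∂μ = ∫ x, f x ∂μ := by
  rw [← hμ (fun x => f (shift x)) (hf.comp continuous_shift)]
  congr 1
  funext x
  have := ruelle_mul_comp_shift A 1 f x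
  rw [hA] at this
  simpa using this

/-- A Hölder Jacobian has at most one Gibbs probability. -/
theorem IsDualFixed.unique [NeZero d] {A : ShiftSpace d → ℝ} (hA : IsNormalized A) (hH : IsHolder A)
    {μ ν : Measure (ShiftSpace d)} [IsProbabilityMeasure μ] [IsProbabilityMeasure ν]
    (hμ : IsDualFixed A μ) (hν : IsDualFixed A ν) : μ = ν := by
  refine ext_of_forall_integral_eq_of_IsFiniteMeasure fun f => ?_
  refine eq_of_forall_dist_le fun ε hε => ?_
  obtain ⟨K, a, b, hab, hK⟩ := hA.exists_iterate_mem_Icc hH f.continuous hε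
  have hc := continuous_ruelle_iterate hH.continuous f.continuous K
  have h1 := integral_mem_Icc hc (hK K le_rfl) μ
  have h2 := integral_mem_Icc hc (hK K le_rfl) ν
  rw [hμ.integral_iterate hH.continuous f.continuous] at h1
  rw [hν.integral_iterate hH.continuous f.continuous] at h2
  rw [Real.dist_eq]
  exact abs_sub_le_iff.2 ⟨by linarith [h1.2, h2.1], by linarith [h2.2, h1.1]⟩

open CompactlySupported in
/-- A Hölder Jacobian has a Gibbs probability. -/
theorem IsNormalized.exists_isDualFixed [NeZero d] {A : ShiftSpace d → ℝ} (hA : IsNormalized A)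
    (hH : IsHolder A) :
    ∃ μ : Measure (ShiftSpace d), IsProbabilityMeasure μ ∧ IsDualFixed A μ := by
  let x₀ : ShiftSpace d := fun _ => 0
  -- The limit of the iterates at one point is a positive linear functional with value `1` at the
  -- constant `1`, and it is unchanged by one more application of the operator; the Riesz measure
  -- represents it. `Λ` is arbitrary off the continuous functions.
  choose! Λ hΛ using fun (f : ShiftSpace d → ℝ) (hf : Continuous f) =>
    hA.exists_tendsto_iterate hH hf x₀
  let Φ : C_c(ShiftSpace d, ℝ) →ₗ[ℝ] ℝ :=
    { toFun := fun f => Λ f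
      map_add' := fun f g => by
        refine tendsto_nhds_unique (hΛ _ (f + g).continuous) ?_
        have := (hΛ _ f.continuous).add (hΛ _ g.continuous)
        simp only [CompactlySupportedContinuousMap.coe_add, ruelle_iterate_add]
        exact this
      map_smul' := fun c f => by
        refine tendsto_nhds_unique (hΛ _ (c • f).continuous) ?_
        have := (hΛ _ f.continuous).const_mul c
        simp only [CompactlySupportedContinuousMap.coe_smul, ruelle_iterate_smul]
        exact this }
  let Ψ : C_c(ShiftSpace d, ℝ) →ₚ[ℝ] ℝ := PositiveLinearMap.mk₀ Φ fun f hf => by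
    obtain ⟨M, -, hM⟩ := exists_bound f.continuous
    exact ge_of_tendsto' (hΛ _ f.continuous) fun k =>
      (hA.iterate_mem_Icc (fun x => ⟨hf x, (le_abs_self _).trans (hM x)⟩) k x₀).1
  let μ := RealRMK.rieszMeasure Ψ
  have hμ : ∀ f : ShiftSpace d → ℝ, Continuous f → ∫ x, f x ∂μ = Λ f := fun f hf =>
    RealRMK.integral_rieszMeasure Ψ ⟨⟨f, hf⟩, HasCompactSupport.of_compactSpace f⟩
  refine ⟨μ, ?_, fun f hf => ?_⟩
  · have h1 : ∫ _, (1 : ℝ) ∂μ = 1 := by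
      rw [hμ _ continuous_const]
      refine tendsto_nhds_unique (hΛ _ continuous_const) ?_
      simp only [hA.iterate_const]
      exact tendsto_const_nhds
    rw [integral_const, smul_eq_mul, mul_one, Measure.real] at h1
    exact ⟨(ENNReal.toReal_eq_one_iff _).1 h1⟩
  · have hc := continuous_ruelle hH.continuous hf
    rw [hμ _ hc, hμ _ hf]
    refine tendsto_nhds_unique (hΛ _ hc) ?_
    simp only [← Function.iterate_succ_apply]
    exact (tendsto_add_atTop_iff_nat 1).2 (hΛ f hf)

end Transfer

/-! ### Positive eigenfunctions and bounds for their eigenvalue. -/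

section Eigenfunction

variable {d : ℕ}

/-- The logarithm of a sum of exponentials. -/
noncomputable def logSumExp (p : Fin d → ℝ) : ℝ := Real.log (∑ a, Real.exp (p a))

theorem sum_exp_pos [NeZero d] (p : Fin d → ℝ) : 0 < ∑ a, Real.exp (p a) :=
  Finset.sum_pos (fun _ _ => Real.exp_pos _) Finset.univ_nonempty

theorem exp_logSumExp [NeZero d] (p : Fin d → ℝ) :
    Real.exp (logSumExp p) = ∑ a, Real.exp (p a) :=
  Real.exp_log (sum_exp_pos p)

theorem continuous_logSumExp [NeZero d] : Continuous (logSumExp : (Fin d → ℝ) → ℝ) :=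
  (continuous_finsetSum _ fun a _ => Real.continuous_exp.comp (continuous_apply a)).log
    fun p => (sum_exp_pos p).ne'

theorem logSumExp_add_const [NeZero d] (p : Fin d → ℝ) (c : ℝ) :
    logSumExp (fun a => p a + c) = logSumExp p + c := by
  apply Real.exp_injective
  rw [Real.exp_add, exp_logSumExp, exp_logSumExp, Finset.sum_mul]
  simp only [Real.exp_add]

theorem logSumExp_mono [NeZero d] {p q : Fin d → ℝ} (h : ∀ a, p a ≤ q a) :
    logSumExp p ≤ logSumExp q :=
  Real.log_le_log (sum_exp_pos p) (Finset.sum_le_sum fun a _ => Real.exp_le_exp.2 (h a))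

theorem abs_logSumExp_sub_le [NeZero d] {p q : Fin d → ℝ} {δ : ℝ} (h : ∀ a, |p a - q a| ≤ δ) :
    |logSumExp p - logSumExp q| ≤ δ := by
  have h1 : logSumExp p ≤ logSumExp q + δ := by
    rw [← logSumExp_add_const]
    exact logSumExp_mono fun a => by linarith [(abs_sub_le_iff.1 (h a)).1]
  have h2 : logSumExp q ≤ logSumExp p + δ := by
    rw [← logSumExp_add_const]
    exact logSumExp_mono fun a => by linarith [(abs_sub_le_iff.1 (h a)).2]
  exact abs_sub_le_iff.2 ⟨by linarith, by linarith⟩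

/-- The discounted transfer equation has a solution whose variations do not depend on the
discount. -/
theorem exists_discounted [NeZero d] {A : ShiftSpace d → ℝ} {C θ : ℝ} (hC : 0 ≤ C) (h0 : 0 < θ)
    (h1 : θ < 1) (hv : GeomVar A C θ) {s : ℝ} (hs0 : 0 ≤ s) (hs1 : s < 1) :
    ∃ u : ShiftSpace d → ℝ, GeomVar u (C / (1 - θ)) θ ∧
      ∀ x, u x = logSumExp fun a => A (prepend a x) + s * u (prepend a x) := by
  have hA : Continuous A := hv.continuous h0 h1
  let T : C(ShiftSpace d, ℝ) → C(ShiftSpace d, ℝ) := fun u =>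
    ⟨fun x => logSumExp fun a => A (prepend a x) + s * u (prepend a x),
      continuous_logSumExp.comp (continuous_pi fun a =>
        (hA.comp (continuous_prepend a)).add
          (continuous_const.mul (u.continuous.comp (continuous_prepend a))))⟩
  have hT : ContractingWith ⟨s, hs0⟩ T := by
    refine ⟨hs1, LipschitzWith.of_dist_le_mul fun u w => ?_⟩
    refine (ContinuousMap.dist_le (mul_nonneg hs0 dist_nonneg)).2 fun x => ?_
    rw [Real.dist_eq]
    refine abs_logSumExp_sub_le fun a => ?_
    rw [add_sub_add_left_eq_sub, ← mul_sub, abs_mul, abs_of_nonneg hs0]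
    rw [← Real.dist_eq]
    exact mul_le_mul_of_nonneg_left (ContinuousMap.dist_apply_le_dist _) hs0
  set u : C(ShiftSpace d, ℝ) := ContractingWith.fixedPoint T hT
  have hfix : T u = u := hT.fixedPoint_isFixedPt
  refine ⟨u, ?_, fun x => (DFunLike.congr_fun hfix x).symm⟩
  have h1' : 0 < 1 - θ := sub_pos.2 h1
  -- The constant is reproduced at each step, because `C + θ C / (1 - θ) = C / (1 - θ)`; bounding
  -- `s` by `1` removes the discount from it. The bound then passes to the fixed point as the limit
  -- of the iterates of `0`.
  have hit : ∀ k, GeomVar (T^[k] 0) (C / (1 - θ)) θ := fun k => by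
    induction k with
    | zero =>
      intro n x y _
      simp only [Function.iterate_zero, id_eq, ContinuousMap.zero_apply, sub_self, abs_zero]
      positivity
    | succ k ih =>
      intro n x y hxy
      rw [Function.iterate_succ_apply']
      refine abs_logSumExp_sub_le fun a => ?_
      have e1 := hv _ _ _ (hxy.prepend a)
      have e2 := ih _ _ _ (hxy.prepend a)
      calc _ = |(A (prepend a x) - A (prepend a y)) +
            s * (T^[k] 0 (prepend a x) - T^[k] 0 (prepend a y))| := by ring_nf
        _ ≤ |A (prepend a x) - A (prepend a y)| +
            s * |T^[k] 0 (prepend a x) - T^[k] 0 (prepend a y)| := by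
          refine (abs_add_le _ _).trans_eq ?_
          rw [abs_mul, abs_of_nonneg hs0]
        _ ≤ C * θ ^ (n + 1) + 1 * (C / (1 - θ) * θ ^ (n + 1)) := by gcongr
        _ ≤ C * θ ^ n + 1 * (C / (1 - θ) * θ ^ (n + 1)) := by
          gcongr C * ?_ + _
          exact pow_le_pow_of_le_one h0.le h1.le n.le_succ
        _ = C / (1 - θ) * θ ^ n := by
          field_simp
          ring
  intro n x y hxy
  have hl : Tendsto (fun k => T^[k] 0) atTop (𝓝 u) := hT.tendsto_iterate_fixedPoint 0
  have hl' : ∀ x, Tendsto (fun k => T^[k] 0 x) atTop (𝓝 (u x)) := fun x =>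
    ((continuous_eval_const (F := C(ShiftSpace d, ℝ)) x).tendsto u).comp hl
  exact le_of_tendsto' ((hl' x).sub (hl' y)).abs fun k => hit k n x y hxy

/-- The Ruelle operator of a Hölder potential has a positive Hölder eigenfunction. -/
theorem exists_eigenfunction [NeZero d] {A : ShiftSpace d → ℝ} (hA : IsHolder A) :
    ∃ (h : ShiftSpace d → ℝ) (c : ℝ), IsHolder h ∧ (∀ x, 0 < h x) ∧ 0 < c ∧
      ∀ x, ruelle A h x = c * h x := by
  obtain ⟨C, θ, hC, h0, h1, hv⟩ := isHolder_iff.1 hA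
  have h1' : 0 < 1 - θ := sub_pos.2 h1
  let s : ℕ → ℝ := fun n => 1 - 1 / ((n : ℝ) + 1)
  have hs1 : ∀ n, s n < 1 := fun n => sub_lt_self _ (by positivity)
  have hs0 : ∀ n, 0 ≤ s n := fun n => by
    have : 1 / ((n : ℝ) + 1) ≤ 1 := div_le_one_of_le₀ (by linarith [n.cast_nonneg (α := ℝ)])
      (by positivity)
    simp only [s]
    linarith
  have hs : Tendsto s atTop (𝓝 1) := by
    simpa [s] using (tendsto_one_div_add_atTop_nhds_zero_nat (𝕜 := ℝ)).const_sub (1 : ℝ)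
  choose u hu hfix using fun n => exists_discounted hC h0 h1 hv (hs0 n) (hs1 n)
  let x₀ : ShiftSpace d := fun _ => 0
  -- The `u n` need not stay bounded as the discount tends to `1`; their differences from the value
  -- at `x₀` do.
  let w : ℕ → ShiftSpace d → ℝ := fun n x => u n x - u n x₀
  have hw : ∀ n, GeomVar (w n) (C / (1 - θ)) θ := fun n k x y hxy => by
    simpa only [w, sub_sub_sub_cancel_right] using hu n k x y hxy
  have hwb : ∀ n x, w n x ∈ Icc (-(C / (1 - θ))) (C / (1 - θ)) := fun n x => by
    have := hu n 0 x x₀ (agreeTo_zero _ _)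
    rw [pow_zero, mul_one] at this
    exact abs_le.1 this
  have heq : ∀ n x, logSumExp (fun a => A (prepend a x) + s n * w n (prepend a x)) - w n x =
      (1 - s n) * u n x₀ := fun n x => by
    have h2 := hfix n x
    have h3 : (fun a => A (prepend a x) + s n * u n (prepend a x)) =
        fun a => (A (prepend a x) + s n * w n (prepend a x)) + s n * u n x₀ := by
      funext a
      simp only [w]
      ring
    rw [h3, logSumExp_add_const] at h2
    simp only [w] at h2 ⊢
    linarith
  -- A pointwise limit along an ultrafilter does the work of a convergent subsequence, and the
  -- common bound on variations survives it.
  let 𝒰 : Ultrafilter ℕ := hyperfilter ℕ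
  have hle : (𝒰 : Filter ℕ) ≤ atTop := Nat.hyperfilter_le_atTop
  have hlim : ∀ x, ∃ l, Tendsto (fun n => w n x) 𝒰 (𝓝 l) := fun x => by
    obtain ⟨l, -, hl⟩ := isCompact_Icc.ultrafilter_le_nhds' (𝒰.map fun n => w n x)
      (Ultrafilter.mem_map.2 (univ_mem' fun n => hwb n x))
    exact ⟨l, hl⟩
  choose v hvl using hlim
  have hvg : GeomVar v (C / (1 - θ)) θ := fun n x y hxy =>
    le_of_tendsto' ((hvl x).sub (hvl y)).abs fun k => hw k n x y hxy
  have hlse : ∀ x, Tendsto (fun n => (1 - s n) * u n x₀) 𝒰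
      (𝓝 (logSumExp (fun a => A (prepend a x) + v (prepend a x)) - v x)) := fun x => by
    simp only [← heq _ x]
    refine Tendsto.sub ((continuous_logSumExp.tendsto _).comp (tendsto_pi_nhds.2 fun a => ?_)) (hvl x)
    simpa using tendsto_const_nhds.add ((hs.mono_left hle).mul (hvl (prepend a x)))
  set κ := logSumExp (fun a => A (prepend a x₀) + v (prepend a x₀)) - v x₀ with hκ
  have hvH : IsHolder v := isHolder_iff.2 ⟨_, θ, by positivity, h0, h1, hvg⟩
  refine ⟨fun x => Real.exp (v x), Real.exp κ, hvH.exp, fun x => Real.exp_pos _, Real.exp_pos _,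
    fun x => ?_⟩
  -- The sequence `(1 - s n) * u n x₀` does not involve `x`, so its limit is the same number `κ` at
  -- every point; exponentiating gives the eigenvalue equation for `e^v`.
  have := tendsto_nhds_unique (hlse x) (hlse x₀)
  rw [← hκ, sub_eq_iff_eq_add] at this
  rw [← Real.exp_add, ← this, exp_logSumExp]
  simp only [ruelle, Real.exp_add]

/-- An upper bound for the main eigenvalue by a positive test function. -/
theorem eigenvalue_le [NeZero d] {A h g : ShiftSpace d → ℝ} {c b : ℝ} (hh : Continuous h)
    (hh0 : ∀ x, 0 < h x) (hc : ∀ x, ruelle A h x = c * h x) (hg : Continuous g)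
    (hg0 : ∀ x, 0 < g x) (hb : ∀ x, ruelle A g x ≤ b * g x) : c ≤ b := by
  -- Where `h / g` is largest, the multiple of `g` touching `h` from above meets it; applying the
  -- positive operator there compares `c` with `b`.
  obtain ⟨x, -, hx⟩ := isCompact_univ.exists_isMaxOn (univ_nonempty (α := ShiftSpace d))
    (hh.div hg fun x => (hg0 x).ne').continuousOn
  have hle : ∀ y, h y ≤ ((h x / g x) • g) y := fun y => by
    rw [Pi.smul_apply, smul_eq_mul, ← div_le_iff₀ (hg0 y)]
    exact hx (mem_univ y)
  have h1 := ruelle_mono A hle x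
  rw [ruelle_smul, hc, Pi.smul_apply, smul_eq_mul] at h1
  have hpos : 0 < h x / g x := div_pos (hh0 x) (hg0 x)
  have h2 : c * h x ≤ b * h x := by
    calc c * h x ≤ h x / g x * ruelle A g x := h1
      _ ≤ h x / g x * (b * g x) := by gcongr; exact hb x
      _ = b * h x := by field_simp [(hg0 x).ne']
  exact le_of_mul_le_mul_right h2 (hh0 x)

/-- A lower bound for the main eigenvalue by a positive test function. -/
theorem le_eigenvalue [NeZero d] {A h g : ShiftSpace d → ℝ} {c b : ℝ} (hh : Continuous h)
    (hh0 : ∀ x, 0 < h x) (hc : ∀ x, ruelle A h x = c * h x) (hg : Continuous g)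
    (hg0 : ∀ x, 0 < g x) (hb : ∀ x, b * g x ≤ ruelle A g x) : b ≤ c := by
  obtain ⟨x, -, hx⟩ := isCompact_univ.exists_isMinOn (univ_nonempty (α := ShiftSpace d))
    (hh.div hg fun x => (hg0 x).ne').continuousOn
  have hle : ∀ y, ((h x / g x) • g) y ≤ h y := fun y => by
    rw [Pi.smul_apply, smul_eq_mul, ← le_div_iff₀ (hg0 y)]
    exact hx (mem_univ y)
  have h1 := ruelle_mono A hle x
  rw [ruelle_smul, hc, Pi.smul_apply, smul_eq_mul] at h1
  have hpos : 0 < h x / g x := div_pos (hh0 x) (hg0 x)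
  have h2 : b * h x ≤ c * h x := by
    calc b * h x = h x / g x * (b * g x) := by field_simp [(hg0 x).ne']
      _ ≤ h x / g x * ruelle A g x := by gcongr; exact hb x
      _ ≤ c * h x := h1
  exact le_of_mul_le_mul_right h2 (hh0 x)

/-- Positive eigenfunctions belong to the same eigenvalue. -/
theorem eigenvalue_unique [NeZero d] {A h g : ShiftSpace d → ℝ} {c b : ℝ} (hh : Continuous h)
    (hh0 : ∀ x, 0 < h x) (hc : ∀ x, ruelle A h x = c * h x) (hg : Continuous g)
    (hg0 : ∀ x, 0 < g x) (hb : ∀ x, ruelle A g x = b * g x) : c = b :=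
  le_antisymm (eigenvalue_le hh hh0 hc hg hg0 fun x => (hb x).le)
    (le_eigenvalue hh hh0 hc hg hg0 fun x => (hb x).ge)

end Eigenfunction

/-! ### Differentiating the logarithm of the eigenvalue. -/

section Pressure

variable {d : ℕ}

/-- With `u = L ψ + ⋯ + L^n ψ`, the expression `L(ψ + u) - u` telescopes to `L^{n+1} ψ`, which for
large `n` is within `ε` of its own integral `∫ ψ dμ`. -/
theorem IsNormalized.exists_approx_coboundary [NeZero d] {A : ShiftSpace d → ℝ}
    (hA : IsNormalized A) (hH : IsHolder A) {μ : Measure (ShiftSpace d)} [IsProbabilityMeasure μ]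
    (hμ : IsDualFixed A μ) {ψ : ShiftSpace d → ℝ} (hψ : Continuous ψ) {ε : ℝ} (hε : 0 < ε) :
    ∃ u : ShiftSpace d → ℝ, Continuous u ∧
      ∀ x, |ruelle A (ψ + u) x - u x - ∫ y, ψ y ∂μ| ≤ ε := by
  have hc := continuous_ruelle_iterate hH.continuous hψ
  have key : ∀ n : ℕ, ∃ u : ShiftSpace d → ℝ, Continuous u ∧
      ∀ x, ruelle A (ψ + u) x - u x = (ruelle A)^[n + 1] ψ x := fun n => by
    induction n with
    | zero =>
      refine ⟨0, continuous_const, fun x => ?_⟩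
      rw [add_zero, Pi.zero_apply, sub_zero]
      rfl
    | succ n ih =>
      obtain ⟨u, hu, h⟩ := ih
      refine ⟨u + (ruelle A)^[n + 1] ψ, hu.add (hc _), fun x => ?_⟩
      have := h x
      rw [← add_assoc, ruelle_add, Pi.add_apply, Pi.add_apply, Function.iterate_succ_apply' (ruelle A) (n + 1)]
      linarith
  obtain ⟨K, a, b, hab, hK⟩ := hA.exists_iterate_mem_Icc hH hψ hε
  obtain ⟨u, hu, h⟩ := key K
  refine ⟨u, hu, fun x => ?_⟩
  have h1 := hK (K + 1) K.le_succ
  have h2 := integral_mem_Icc (hc (K + 1)) h1 μ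
  rw [hμ.integral_iterate hH.continuous hψ] at h2
  rw [h x]
  exact abs_sub_le_iff.2 ⟨by linarith [(h1 x).2, h2.1], by linarith [(h1 x).1, h2.2]⟩

theorem exp_le_one_add_add_sq {y : ℝ} (hy : |y| ≤ 1) : Real.exp y ≤ 1 + y + y ^ 2 := by
  have := (abs_le.1 (Real.abs_exp_sub_one_sub_id_le hy)).2
  linarith

/-- The derivative of the logarithm of the main eigenvalue at a normalized potential. -/
theorem IsNormalized.hasDerivAt_log_eigenvalue [NeZero d] {A : ShiftSpace d → ℝ}
    (hA : IsNormalized A) (hH : IsHolder A) {μ : Measure (ShiftSpace d)} [IsProbabilityMeasure μ]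
    (hμ : IsDualFixed A μ) {ψ : ShiftSpace d → ℝ} (hψ : Continuous ψ)
    (h : ℝ → ShiftSpace d → ℝ) (c : ℝ → ℝ) (hh : ∀ t, Continuous (h t)) (hh0 : ∀ t x, 0 < h t x)
    (hc0 : ∀ t, 0 < c t) (hc : ∀ t x, ruelle (fun y => A y + t * ψ y) (h t) x = c t * h t x) :
    HasDerivAt (fun t => Real.log (c t)) (∫ x, ψ x ∂μ) 0 := by
  have hp := hA.sum_exp
  set m := ∫ x, ψ x ∂μ with hm
  have bound : ∀ ε > 0, ∃ W : ℝ, 0 ≤ W ∧ ∀ t : ℝ, |t| * W ≤ 1 →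
      |Real.log (c t) - t * m| ≤ |t| * ε + t ^ 2 * W ^ 2 := fun ε hε => by
    obtain ⟨u, hu, hum⟩ := hA.exists_approx_coboundary hH hμ hψ hε
    obtain ⟨M, hM0, hM⟩ := exists_bound (hψ.add hu)
    obtain ⟨N, hN0, hN⟩ := exists_bound hu
    refine ⟨M + N, by positivity, fun t ht => ?_⟩
    let r : ShiftSpace d → ℝ := fun x => ruelle A (ψ + u) x - u x
    let w : Fin d → ShiftSpace d → ℝ := fun a x =>
      ψ (prepend a x) + u (prepend a x) - u x
    have hw : ∀ a x, |w a x| ≤ M + N := fun a x =>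
      (abs_sub _ _).trans (add_le_add (hM _) (hN _))
    have hr : ∀ x, ∑ a, Real.exp (A (prepend a x)) * w a x = r x := fun x => by
      simp only [w, r, mul_sub, Finset.sum_sub_distrib, ← Finset.sum_mul, hp, one_mul]
      rfl
    -- For this `g` the quotient `L_{A+tψ} g / g` is the average of `e^{t w}` with weights `e^A`,
    -- and `w` has average `r`, within `ε` of `m`.
    let g : ShiftSpace d → ℝ := fun x => Real.exp (t * u x)
    have hg : Continuous g := Real.continuous_exp.comp (continuous_const.mul hu)
    have hg0 : ∀ x, 0 < g x := fun x => Real.exp_pos _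
    have hgL : ∀ x, ruelle (fun y => A y + t * ψ y) g x =
        (∑ a, Real.exp (A (prepend a x)) * Real.exp (t * w a x)) * g x := fun x => by
      simp only [ruelle, g, w, Finset.sum_mul, ← Real.exp_add]
      refine Finset.sum_congr rfl fun a _ => ?_
      ring_nf
    have htr : ∀ x, |t * r x - t * m| ≤ |t| * ε := fun x => by
      rw [← mul_sub, abs_mul]
      exact mul_le_mul_of_nonneg_left (hum x) (abs_nonneg t)
    -- Jensen's inequality for the exponential, via its tangent line at `t * r x`.
    have hlow : Real.exp (t * m - |t| * ε) ≤ c t := by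
      refine le_eigenvalue (hh t) (hh0 t) (hc t) hg hg0 fun x => ?_
      rw [hgL]
      refine mul_le_mul_of_nonneg_right ?_ (hg0 x).le
      calc Real.exp (t * m - |t| * ε) ≤ Real.exp (t * r x) :=
            Real.exp_le_exp.2 (by linarith [(abs_le.1 (htr x)).1])
        _ = ∑ a, Real.exp (A (prepend a x)) * (Real.exp (t * r x) * (t * w a x - t * r x + 1)) := by
          have : ∀ a, Real.exp (A (prepend a x)) * (Real.exp (t * r x) * (t * w a x - t * r x + 1)) =
              Real.exp (t * r x) * (t * (Real.exp (A (prepend a x)) * w a x) +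
                (1 - t * r x) * Real.exp (A (prepend a x))) := fun a => by ring
          simp only [this, ← Finset.mul_sum, Finset.sum_add_distrib, hr, hp]
          ring
        _ ≤ ∑ a, Real.exp (A (prepend a x)) * Real.exp (t * w a x) := by
          refine Finset.sum_le_sum fun a _ => mul_le_mul_of_nonneg_left ?_ (Real.exp_pos _).le
          calc _ ≤ Real.exp (t * r x) * Real.exp (t * w a x - t * r x) :=
                mul_le_mul_of_nonneg_left (Real.add_one_le_exp _) (Real.exp_pos _).le
            _ = _ := by rw [← Real.exp_add]; ring_nf
    have hup : c t ≤ Real.exp (t * m + |t| * ε + t ^ 2 * (M + N) ^ 2) := by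
      refine eigenvalue_le (hh t) (hh0 t) (hc t) hg hg0 fun x => ?_
      rw [hgL]
      refine mul_le_mul_of_nonneg_right ?_ (hg0 x).le
      have hone : ∀ a, |t * w a x| ≤ 1 := fun a => by
        rw [abs_mul]
        exact (mul_le_mul_of_nonneg_left (hw a x) (abs_nonneg t)).trans ht
      calc ∑ a, Real.exp (A (prepend a x)) * Real.exp (t * w a x)
          ≤ ∑ a, Real.exp (A (prepend a x)) * (1 + t * w a x + t ^ 2 * (M + N) ^ 2) := by
            refine Finset.sum_le_sum fun a _ => mul_le_mul_of_nonneg_left ?_ (Real.exp_pos _).le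
            have h2 : (w a x) ^ 2 ≤ (M + N) ^ 2 := sq_le_sq' (abs_le.1 (hw a x)).1 (abs_le.1 (hw a x)).2
            calc _ ≤ 1 + t * w a x + (t * w a x) ^ 2 := exp_le_one_add_add_sq (hone a)
              _ ≤ _ := by rw [mul_pow]; gcongr
        _ = t * r x + t ^ 2 * (M + N) ^ 2 + 1 := by
          have : ∀ a, Real.exp (A (prepend a x)) * (1 + t * w a x + t ^ 2 * (M + N) ^ 2) =
              t * (Real.exp (A (prepend a x)) * w a x) +
                (1 + t ^ 2 * (M + N) ^ 2) * Real.exp (A (prepend a x)) := fun a => by ring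
          simp only [this, ← Finset.mul_sum, Finset.sum_add_distrib, hr, hp]
          ring
        _ ≤ Real.exp (t * r x + t ^ 2 * (M + N) ^ 2) := Real.add_one_le_exp _
        _ ≤ _ := Real.exp_le_exp.2 (by linarith [(abs_le.1 (htr x)).2])
    rw [← Real.le_log_iff_exp_le (hc0 t)] at hlow
    rw [← Real.log_le_iff_le_exp (hc0 t)] at hup
    have : 0 ≤ t ^ 2 * (M + N) ^ 2 := by positivity
    exact abs_le.2 ⟨by linarith, by linarith⟩
  have hzero : Real.log (c 0) = 0 := by
    obtain ⟨W, hW, h1⟩ := bound 1 one_pos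
    have := h1 0 (by simp)
    simpa using this
  rw [hasDerivAt_iff_isLittleO_nhds_zero, Asymptotics.isLittleO_iff]
  intro ε hε
  -- `W` depends on `ε`, but it is fixed before `t` tends to `0`, so the quadratic term is still
  -- negligible.
  obtain ⟨W, hW, hb⟩ := bound (ε / 2) (half_pos hε)
  have h1 : ∀ᶠ t : ℝ in 𝓝 0, |t| * W < 1 :=
    (Continuous.tendsto' (by fun_prop) 0 0 (by simp)).eventually (gt_mem_nhds one_pos)
  have h2 : ∀ᶠ t : ℝ in 𝓝 0, |t| * W ^ 2 < ε / 2 :=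
    (Continuous.tendsto' (by fun_prop) 0 0 (by simp)).eventually (gt_mem_nhds (half_pos hε))
  filter_upwards [h1, h2] with t ht1 ht2
  rw [zero_add, hzero, sub_zero, smul_eq_mul, Real.norm_eq_abs, Real.norm_eq_abs]
  calc _ ≤ |t| * (ε / 2) + t ^ 2 * W ^ 2 := hb t ht1.le
    _ = |t| * (ε / 2) + |t| * (|t| * W ^ 2) := by rw [← sq_abs t]; ring
    _ ≤ |t| * (ε / 2) + |t| * (ε / 2) := by gcongr
    _ = ε * |t| := by ring

end Pressure

/-! ### Equilibrium states and the divergence. -/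

section Equilibrium

variable {d : ℕ}

theorem IsJacobian.isHolder_log [NeZero d] {J : ShiftSpace d → ℝ} (hJ : IsJacobian J) :
    IsHolder fun x => Real.log (J x) :=
  hJ.holder.log hJ.pos

theorem isHolder_logInterp [NeZero d] (ν₀ ν₂ : GibbsState d) (t : ℝ) :
    IsHolder (logInterp ν₀.J ν₂.J t) :=
  (ν₂.isJacobian.isHolder_log.const_mul t).add (ν₀.isJacobian.isHolder_log.const_mul (1 - t))

/-- A Gibbs state is determined by its Jacobian. -/
theorem GibbsState.ext_jacobian [NeZero d] {ν ν' : GibbsState d} (h : ν.J = ν'.J) : ν = ν' := by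
  have := ν.isProbabilityMeasure
  have := ν'.isProbabilityMeasure
  refine GibbsState.ext h (IsDualFixed.unique ν.isJacobian.ruelle_one ν.isJacobian.isHolder_log
    ν.dual_ruelle ?_)
  rw [h]
  exact ν'.dual_ruelle

/-- Normalizing conjugates the operator by multiplication by `h` and divides it by `c`. Hence an
eigenfunction `h` with eigenvalue `c` makes `1` fixed, and a second one `h'` makes `h' / h` fixed.
-/
theorem ruelle_normalization (A h : ShiftSpace d → ℝ) {c : ℝ} (h0 : ∀ x, 0 < h x) (hc : 0 < c)
    (f : ShiftSpace d → ℝ) (x : ShiftSpace d) :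
    ruelle (fun y => A y + Real.log (h y) - Real.log (h (shift y)) - Real.log c) f x =
      ruelle A (fun y => h y * f y) x / (c * h x) := by
  simp only [ruelle, shift_prepend, Finset.sum_div]
  refine Finset.sum_congr rfl fun a _ => ?_
  rw [Real.exp_sub, Real.exp_sub, Real.exp_add, Real.exp_log (h0 _), Real.exp_log (h0 _),
    Real.exp_log hc]
  have := (h0 x).ne'
  field_simp

/-- A Hölder potential has an equilibrium state. -/
theorem exists_isEquilibriumState [NeZero d] {A : ShiftSpace d → ℝ} (hA : IsHolder A) :
    ∃ ν : GibbsState d, IsEquilibriumState A ν := by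
  obtain ⟨h, c, hh, hh0, hc, heig⟩ := exists_eigenfunction hA
  have hl := hh.log hh0
  set B : ShiftSpace d → ℝ :=
    fun x => A x + Real.log (h x) - Real.log (h (shift x)) - Real.log c with hB
  have hBH : IsHolder B := ((hA.add hl).sub hl.comp_shift).sub (isHolder_const _)
  have hBn : IsNormalized B := by
    funext x
    rw [hB, ruelle_normalization A h hh0 hc]
    simp only [Pi.one_apply, mul_one]
    rw [heig, div_self (mul_pos hc (hh0 x)).ne']
  obtain ⟨μ, hμ, hfix⟩ := hBn.exists_isDualFixed hBH
  have hlog : (fun x => Real.log (Real.exp (B x))) = B := funext fun x => Real.log_exp _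
  refine ⟨⟨fun x => Real.exp (B x), μ, ⟨fun x => Real.exp_pos _, hBH.exp, ?_⟩, hμ, ?_⟩,
    h, c, hh, hh0, hc, heig, fun x => Real.log_exp _⟩
  · rw [hlog]
    exact hBn
  · rw [hlog]
    exact hfix

/-- The equilibrium state of a potential is unique. -/
theorem IsEquilibriumState.unique [NeZero d] {A : ShiftSpace d → ℝ} {ν ν' : GibbsState d}
    (hν : IsEquilibriumState A ν) (hν' : IsEquilibriumState A ν') : ν = ν' := by
  obtain ⟨h, c, hh, hh0, hc, heig, hJ⟩ := hν
  obtain ⟨h', c', hh', hh0', hc', heig', hJ'⟩ := hν'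
  obtain rfl : c = c' :=
    eigenvalue_unique hh.continuous hh0 heig hh'.continuous hh0' heig'
  have hfix : ruelle (fun y => Real.log (ν.J y)) (fun x => h' x / h x) = fun x => h' x / h x := by
    funext x
    rw [funext hJ, ruelle_normalization A h hh0 hc]
    have : (fun y => h y * (h' y / h y)) = h' := funext fun y => mul_div_cancel₀ _ (hh0 y).ne'
    rw [this, heig', mul_div_mul_left _ _ hc.ne']
  have hconst := IsNormalized.eq_of_ruelle_eq_self ν.isJacobian.ruelle_one
    ν.isJacobian.isHolder_log (hh'.continuous.div hh.continuous fun x => (hh0 x).ne') hfix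
  refine GibbsState.ext_jacobian (funext fun x => ?_)
  rw [← Real.exp_log (ν.isJacobian.pos x), ← Real.exp_log (ν'.isJacobian.pos x), hJ, hJ']
  -- As `h' / h` is constant, `log h` and `log h'` have the same coboundary.
  have := congrArg Real.log (hconst x (shift x))
  rw [Pi.div_apply, Pi.div_apply, Real.log_div (hh0' _).ne' (hh0 _).ne', Real.log_div (hh0' _).ne' (hh0 _).ne'] at this
  congr 1
  linarith

/-- A Gibbs state is the equilibrium state of the logarithm of its Jacobian. -/
theorem GibbsState.isEquilibriumState (ν : GibbsState d) :
    IsEquilibriumState (fun x => Real.log (ν.J x)) ν :=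
  ⟨1, 1, isHolder_const 1, fun _ => one_pos, one_pos,
    fun x => by rw [ν.isJacobian.ruelle_one, one_mul], fun x => by simp⟩

theorem GibbsState.integrable_log [NeZero d] (ν ρ : GibbsState d) :
    Integrable (fun x => Real.log (ρ.J x)) ν.μ :=
  have := ν.isProbabilityMeasure
  integrable_of_continuous ρ.isJacobian.isHolder_log.continuous _

/-- The divergence from a Gibbs state to an equilibrium state, in terms of the potential and of the
main eigenvalue. -/
theorem DKL_eq_of_normalization [NeZero d] (ν ρ : GibbsState d) {A h : ShiftSpace d → ℝ} {c : ℝ}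
    (hA : Continuous A) (hh : Continuous h) (hh0 : ∀ x, 0 < h x)
    (hJ : ∀ x, Real.log (ρ.J x) =
      A x + Real.log (h x) - Real.log (h (shift x)) - Real.log c) :
    DKL ν ρ = ∫ x, Real.log (ν.J x) ∂ν.μ - ∫ x, A x ∂ν.μ + Real.log c := by
  have := ν.isProbabilityMeasure
  have hl : Continuous fun x => Real.log (h x) := hh.log fun x => (hh0 x).ne'
  have hls : Continuous fun x => Real.log (h (shift x)) := hl.comp continuous_shift
  have hinv : ∫ x, Real.log (h (shift x)) ∂ν.μ = ∫ x, Real.log (h x) ∂ν.μ :=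
    IsDualFixed.integral_comp_shift ν.isJacobian.ruelle_one ν.dual_ruelle hl
  have i1 := integrable_of_continuous hA ν.μ
  have i2 := integrable_of_continuous hl ν.μ
  have i3 := integrable_of_continuous hls ν.μ
  have i12 : Integrable (fun x => A x + Real.log (h x)) ν.μ := i1.add i2
  have i123 : Integrable (fun x => A x + Real.log (h x) - Real.log (h (shift x))) ν.μ :=
    i12.sub i3
  rw [DKL, integral_sub (ν.integrable_log ν) (ν.integrable_log ρ), funext hJ,
    integral_sub i123 (integrable_const _), integral_sub i12 i3, integral_add i1 i2, hinv]
  simp only [integral_const, probReal_univ, one_smul]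
  ring

end Equilibrium

end ShiftThermo

/-! ### The main theorem. -/

open ShiftThermo in
theorem proposition1p4 (d : ℕ) (hd : 2 ≤ d) (ν₀ ν₁ ν₂ : ShiftThermo.GibbsState d) :
    -- the equilibrium state of `t log J₂ + (1 - t) log J₀` exists and is unique
    (∀ t : ℝ, ∃! ν : ShiftThermo.GibbsState d,
      ShiftThermo.IsEquilibriumState (ShiftThermo.logInterp ν₀.J ν₂.J t) ν) ∧
    -- and, `ν t` being that state,
    ∀ ν : ℝ → ShiftThermo.GibbsState d,
      (∀ t : ℝ, ShiftThermo.IsEquilibriumState (ShiftThermo.logInterp ν₀.J ν₂.J t) (ν t)) →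
      ν 0 = ν₀ ∧ ν 1 = ν₂ ∧
      HasDerivAt (fun t => ShiftThermo.DKL ν₁ (ν t))
        (-(∫ x, (Real.log (ν₂.J x) - Real.log (ν₀.J x)) ∂ν₁.μ)
          + ∫ x, (Real.log (ν₂.J x) - Real.log (ν₀.J x)) ∂ν₀.μ) 0 ∧
      (0 ≤ deriv (fun t => ShiftThermo.DKL ν₁ (ν t)) 0 ↔
        ShiftThermo.DKL ν₁ ν₀ + ShiftThermo.DKL ν₀ ν₂ ≤ ShiftThermo.DKL ν₁ ν₂) := by
  have : NeZero d := ⟨by omega⟩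
  refine ⟨fun t => ?_, fun ν hν => ?_⟩
  · obtain ⟨ρ, hρ⟩ := exists_isEquilibriumState (isHolder_logInterp ν₀ ν₂ t)
    exact ⟨ρ, hρ, fun ρ' hρ' => hρ'.unique hρ⟩
  have e0 : logInterp ν₀.J ν₂.J 0 = fun x => Real.log (ν₀.J x) := by
    funext x
    simp [logInterp]
  have e1 : logInterp ν₀.J ν₂.J 1 = fun x => Real.log (ν₂.J x) := by
    funext x
    simp [logInterp]
  have hint : ∀ ρ : GibbsState d, ∫ x, (Real.log (ν₂.J x) - Real.log (ν₀.J x)) ∂ρ.μ =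
      ∫ x, Real.log (ν₂.J x) ∂ρ.μ - ∫ x, Real.log (ν₀.J x) ∂ρ.μ := fun ρ =>
    integral_sub (ρ.integrable_log ν₂) (ρ.integrable_log ν₀)
  have hderiv : HasDerivAt (fun t => DKL ν₁ (ν t))
      (-(∫ x, (Real.log (ν₂.J x) - Real.log (ν₀.J x)) ∂ν₁.μ)
        + ∫ x, (Real.log (ν₂.J x) - Real.log (ν₀.J x)) ∂ν₀.μ) 0 := by
    -- The eigenfunctions are picked separately for each `t`; no regularity in `t` is needed of
    -- them.
    choose h c hh hh0 hc heig hJ using hν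
    have hp : ∀ t, logInterp ν₀.J ν₂.J t = fun y =>
        Real.log (ν₀.J y) + t * (Real.log (ν₂.J y) - Real.log (ν₀.J y)) := fun t => by
      funext y
      simp only [logInterp]
      ring
    have := ν₀.isProbabilityMeasure
    have hP := IsNormalized.hasDerivAt_log_eigenvalue ν₀.isJacobian.ruelle_one
      ν₀.isJacobian.isHolder_log (μ := ν₀.μ) ν₀.dual_ruelle
      (ν₂.isJacobian.isHolder_log.sub ν₀.isJacobian.isHolder_log).continuous h c
      (fun t => (hh t).continuous) hh0 hc (fun t x => by rw [← hp t]; exact heig t x)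
    set m := ∫ x, (Real.log (ν₂.J x) - Real.log (ν₀.J x)) ∂ν₁.μ with hm
    have hD : (fun t => DKL ν₁ (ν t)) = fun t =>
        (∫ x, Real.log (ν₁.J x) ∂ν₁.μ - (∫ x, Real.log (ν₀.J x) ∂ν₁.μ + t * m)) +
          Real.log (c t) := by
      funext t
      have hi : Integrable (fun x => t * (Real.log (ν₂.J x) - Real.log (ν₀.J x))) ν₁.μ :=
        ((ν₁.integrable_log ν₂).sub (ν₁.integrable_log ν₀)).const_mul t
      rw [DKL_eq_of_normalization ν₁ (ν t) (isHolder_logInterp ν₀ ν₂ t).continuous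
        (hh t).continuous (hh0 t) (hJ t), hp t, integral_add (ν₁.integrable_log ν₀) hi,
        integral_const_mul]
    rw [hD]
    have hl : HasDerivAt (fun t : ℝ => ∫ x, Real.log (ν₁.J x) ∂ν₁.μ -
        (∫ x, Real.log (ν₀.J x) ∂ν₁.μ + t * m)) (-m) 0 := by
      simpa using (((hasDerivAt_id (0 : ℝ)).mul_const m).const_add _).const_sub _
    exact hl.add hP
  refine ⟨(hν 0).unique (e0 ▸ ν₀.isEquilibriumState), (hν 1).unique (e1 ▸ ν₂.isEquilibriumState),
    hderiv, ?_⟩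
  -- Once expanded into integrals of `log Jᵢ`, the derivative is exactly the gap in the Pythagorean
  -- inequality.
  rw [hderiv.deriv, hint, hint, DKL, DKL, DKL,
    integral_sub (ν₁.integrable_log ν₁) (ν₁.integrable_log ν₀),
    integral_sub (ν₀.integrable_log ν₀) (ν₀.integrable_log ν₂),
    integral_sub (ν₁.integrable_log ν₁) (ν₁.integrable_log ν₂)]
  constructor <;> intro h <;> linarith
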